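/- Let $(\mathcal S,\mathcal A,H,\alpha,P,r)$ be a finite episodic Markov decision process with $S=|\mathcal S|$ states, $A=|\mathcal A|$ actions, episode length $H$, initial-state distribution $\alpha$, transition function $P(x'\mid x,a)$ (the same at all stages) and known deterministic rewards $r_h(x,a)\in[0,1]$, $h=1,\dots,H$. A policy $\pi=(\pi_h)_{h=1}^H$ consists of maps $\pi_h:\mathcal S\to\mathcal A$. For a stage-indexed transition function $p=(p_h)_{h=1}^H$ let $V_1^{\pi,p}(x)=\mathbb E_{\pi,p}\big[\sum_{h=1}^H r_h(x_h,\pi_h(x_h))\,\big|\,x_1=x\big]$, and write $V_1^\pi=V_1^{\pi,P}$, $V_1^*(x)=\max_\pi V_1^\pi(x)$. A learner interacts with the MDP for $K$ episodes: in episode $t$ an initial state $x_{1,t}\sim\alpha$ is drawn, the learner picks a policy $\pi_t$ from the information available so far (including $x_{1,t}$), and for $h=1,\dots,H$ it plays $a_{h,t}=\pi_{t,h}(x_{h,t})$ and the next state is drawn as $x_{h+1,t}\sim P(\cdot\mid x_{h,t},a_{h,t})$. Let $T=KH$ and $$\mathrm{Reg}_T=\sum_{t=1}^K\big(V_1^*(x_{1,t})-V_1^{\pi_t}(x_{1,t})\big).$$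 Let $\delta\in(0,1)$ and $c\ge 4$. Let $N_t(x,a)$ and $N_t(x,a,x')$ be the numbers of visits to $(x,a)$ and of observed transitions $(x,a,x')$ in the episodes before episode $t$, $N_t^+=\max\{N_t,1\}$, $\widehat P_t(x'\mid x,a)=N_t(x,a,x')/N_t^+(x,a)$, and $$\varepsilon_t(x,a)=\sqrt{\frac{c\,S\log(2SAT/\delta)}{N_t^+(x,a)}}.$$ Let $\mathcal P_t$ be the set of all $p=(p_h)_{h=1}^H$ such that, for all $x,a,h$, $p_h(\cdot\mid x,a)$ is a probability distribution on $\mathcal S$ with $\|p_h(\cdot\mid x,a)-\widehat P_t(\cdot\mid x,a)\|_1\le\varepsilon_t(x,a)$. UCRL2 follows in each episode $t$ a policy $\pi_t$ that, together with some $\widetilde P_t\in\mathcal P_t$, maximizes $V_1^{\pi,p}(x_{1,t})$ over all policies $\pi$ and all $p\in\mathcal P_t$ (ties broken arbitrarily). Then, with probability at least $1-2\delta$, the regret of UCRL2 satisfies $$\mathrm{Reg}_T\le C\,HS\sqrt{AT}+2H\sqrt{2T\log(1/\delta)},\qquad C=4\sqrt{c\log(2SAT/\delta)}.$$ -/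

import Mathlib

open MeasureTheory
open scoped Classical

noncomputable section

namespace UCRL

/-- A policy for an episode of length `H`: one map from states to actions per stage. -/
abbrev Policy (S A : Type*) (H : ℕ) := Fin H → S → A

/-- A (possibly stage-dependent) transition function: `p h x a y` is the weight of moving to `y`
when playing `a` in state `x` at stage `h`. -/
abbrev Transition (S A : Type*) (H : ℕ) := Fin H → S → A → S → ℝ

/-- A finite episodic Markov decision process with episode length `H`, initial-state distribution
`init`, transition function `trans` and deterministic rewards with values in `[0, 1]`. -/
structure EpisodicMDP (S A : Type*) [Fintype S] (H : ℕ) where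
  init : S → ℝ
  init_mem : init ∈ stdSimplex ℝ S
  trans : S → A → S → ℝ
  trans_mem : ∀ x a, trans x a ∈ stdSimplex ℝ S
  reward : Fin H → S → A → ℝ
  reward_mem : ∀ h x a, reward h x a ∈ Set.Icc (0 : ℝ) 1

section Planning

variable {S A : Type*} [Fintype S] {H : ℕ}

/-- Probability of the state trajectory `τ` given its first state, when following `π` under the
transition function `p`. -/
def pathProb (p : Transition S A H) (π : Policy S A H) (τ : Fin (H + 1) → S) : ℝ :=
  ∏ h : Fin H, p h (τ h.castSucc) (π h (τ h.castSucc)) (τ h.succ)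

/-- Total reward collected along the trajectory `τ` when following `π`. -/
def pathReward (r : Fin H → S → A → ℝ) (π : Policy S A H) (τ : Fin (H + 1) → S) : ℝ :=
  ∑ h : Fin H, r h (τ h.castSucc) (π h (τ h.castSucc))

/-- First-stage value at `x`: the expected total reward of an episode that starts in `x` and
follows `π` under the transition function `p`. -/
def valueFn (r : Fin H → S → A → ℝ) (p : Transition S A H) (π : Policy S A H) (x : S) : ℝ :=
  ∑ τ : Fin (H + 1) → S, if τ 0 = x then pathProb p π τ * pathReward r π τ else 0

/-- The value `V₁^π(x)` of `π` in the MDP `M`. -/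
def EpisodicMDP.value (M : EpisodicMDP S A H) (π : Policy S A H) (x : S) : ℝ :=
  valueFn M.reward (fun _ => M.trans) π x

/-- The optimal value `V₁^*(x)`: the maximum of `V₁^π(x)` over the finitely many policies. -/
def EpisodicMDP.optValue [Fintype A] (M : EpisodicMDP S A H) (x : S) : ℝ :=
  ⨆ π : Policy S A H, M.value π x

end Planning

section Algorithm

variable {S A : Type*} [Fintype S] {H K : ℕ}

/-- Number of visits to `(x, a)` in the episodes before episode `k`; here `s j h` is the state at
stage `h` of episode `j`, and `π j` is the policy followed in episode `j`. -/
def visits (s : Fin K → Fin (H + 1) → S) (π : Fin K → Policy S A H) (k : Fin K)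
    (x : S) (a : A) : ℕ :=
  ∑ j ∈ Finset.Iio k, ∑ h : Fin H,
    if s j h.castSucc = x ∧ π j h (s j h.castSucc) = a then 1 else 0

/-- Number of observed transitions `(x, a, y)` in the episodes before episode `k`. -/
def transVisits (s : Fin K → Fin (H + 1) → S) (π : Fin K → Policy S A H) (k : Fin K)
    (x : S) (a : A) (y : S) : ℕ :=
  ∑ j ∈ Finset.Iio k, ∑ h : Fin H,
    if s j h.castSucc = x ∧ π j h (s j h.castSucc) = a ∧ s j h.succ = y then 1 else 0

/-- The empirical transition function `N(x, a, y) / max {N(x, a), 1}` at the start of episode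
`k`. -/
def empTrans (s : Fin K → Fin (H + 1) → S) (π : Fin K → Policy S A H) (k : Fin K)
    (x : S) (a : A) (y : S) : ℝ :=
  (transVisits s π k x a y : ℝ) / ((max (visits s π k x a) 1 : ℕ) : ℝ)

/-- The logarithmic factor `log (2 S A T / δ)`, with `T = K H` the total number of rounds. -/
def logFactor (S A : Type*) [Fintype S] [Fintype A] (H K : ℕ) (δ : ℝ) : ℝ :=
  Real.log (2 * (Fintype.card S : ℝ) * (Fintype.card A : ℝ) * ((K : ℝ) * (H : ℝ)) / δ)

/-- The `ℓ₁` confidence width `√(c S log (2 S A T / δ) / max {N(x, a), 1})`. -/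
def width [Fintype A] (c δ : ℝ) (s : Fin K → Fin (H + 1) → S) (π : Fin K → Policy S A H)
    (k : Fin K) (x : S) (a : A) : ℝ :=
  √(c * (Fintype.card S : ℝ) * logFactor S A H K δ / ((max (visits s π k x a) 1 : ℕ) : ℝ))

/-- The confidence set of episode `k`: the transition functions within `ℓ₁` distance `width` of
the empirical transition function, at all stages, states and actions. -/
def plausible [Fintype A] (c δ : ℝ) (s : Fin K → Fin (H + 1) → S) (π : Fin K → Policy S A H)
    (k : Fin K) : Set (Transition S A H) :=
  {p | ∀ h x a, p h x a ∈ stdSimplex ℝ S ∧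
    ∑ y, |p h x a y - empTrans s π k x a y| ≤ width c δ s π k x a}

/-- The run `(s, π)` is a run of UCRL2 on rewards `r`: in each episode `k` the policy `π k` is the
policy part of a maximizer, over all pairs of a policy and a plausible transition function, of the
expected total reward from the initial state of the episode. -/
def IsUCRL2Run [Fintype A] (r : Fin H → S → A → ℝ) (c δ : ℝ) (s : Fin K → Fin (H + 1) → S)
    (π : Fin K → Policy S A H) : Prop :=
  ∀ k, ∃ p ∈ plausible c δ s π k, ∀ π' : Policy S A H, ∀ p' ∈ plausible c δ s π k,
    valueFn r p' π' (s k 0) ≤ valueFn r p (π k) (s k 0)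

/-- The regret `∑ k, (V₁^*(x_{1,k}) - V₁^{π_k}(x_{1,k}))` of a run of `K` episodes. -/
def regret [Fintype A] (M : EpisodicMDP S A H) (s : Fin K → Fin (H + 1) → S)
    (π : Fin K → Policy S A H) : ℝ :=
  ∑ k, (M.optValue (s k 0) - M.value (π k) (s k 0))

end Algorithm

/-- Interaction of a learner with the MDP `M` for `K` episodes. `X k h` is the state at stage `h`
of episode `k` and `π k` the policy followed in episode `k`. The filtration is indexed by the
draws of states in chronological order: `ℱ (k * (H + 1) + h)` is the information (including any
private randomness of the learner) available just before `X k h` is drawn. The policy of episode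
`k` is chosen once its initial state has been observed. -/
structure IsInteraction {S A Ω : Type*} [Fintype S] {H K : ℕ} {mΩ : MeasurableSpace Ω}
    (M : EpisodicMDP S A H) (μ : Measure Ω) (ℱ : Filtration ℕ mΩ)
    (X : Fin K → Fin (H + 1) → Ω → S) (π : Fin K → Ω → Policy S A H) : Prop where
  state_meas : ∀ (k : Fin K) (h : Fin (H + 1)) (x : S),
    MeasurableSet[ℱ ((k : ℕ) * (H + 1) + (h : ℕ) + 1)] {ω | X k h ω = x}
  policy_meas : ∀ (k : Fin K) (π₀ : Policy S A H),
    MeasurableSet[ℱ ((k : ℕ) * (H + 1) + 1)] {ω | π k ω = π₀}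
  init_law : ∀ (k : Fin K) (x : S),
    μ[fun ω => if X k 0 ω = x then (1 : ℝ) else 0 | ℱ ((k : ℕ) * (H + 1))]
      =ᵐ[μ] fun _ => M.init x
  trans_law : ∀ (k : Fin K) (h : Fin H) (y : S),
    μ[fun ω => if X k h.succ ω = y then (1 : ℝ) else 0 | ℱ ((k : ℕ) * (H + 1) + (h : ℕ) + 1)]
      =ᵐ[μ] fun ω => M.trans (X k h.castSucc ω) (π k ω h (X k h.castSucc ω)) y

end UCRL

end

/-! The proof combines optimism with two concentration bounds, each failing with probability at most
`δ`.

Confidence sets (`measureReal_not_plausible_le`): an `ℓ₁` distance is a maximum of linear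
functionals over sign vectors. For each one, the deviation of the observed transitions is controlled
by an exponential supermartingale, and a union bound over episodes, pairs, sign vectors and visit
counts puts the true model in every confidence set.

Regret on that event (`regret_le_of_plausible`): the optimistic value dominates `V₁^*`, so the
regret is at most the sum of the gaps between optimistic and true values of the policies played.
Along the realised trajectory each gap telescopes (`valueFn_sub_valueFn`) into model errors, at most
`H * min 1 (B / √N)` with `B = √(c S L)`, `L` the logarithmic factor, plus martingale differences
bounded by Azuma (`measureReal_deviation_le`). Counters stay frozen within an episode, so summing
the widths (`sum_mul_min_le`) costs an extra `2H` per pair.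

The resulting term `2 H² S A` is absorbed by a case split. If `T` is at most the main term, the
trivial bound `T` on the regret suffices; otherwise `T` is large enough for `regret_term_le` to
raise the constant `5/2` to `4`. -/

noncomputable section

namespace UCRL

/-! ### Values as path sums and by backward induction. -/

section Planning

variable {S A : Type*} {H : ℕ}

lemma pathProb_cons (p : Transition S A (H + 1)) (π : Policy S A (H + 1)) (x : S)
    (τ : Fin (H + 1) → S) :
    pathProb p π (Fin.cons x τ) =
      p 0 x (π 0 x) (τ 0) * pathProb (Fin.tail p) (Fin.tail π) τ := by
  simp only [pathProb, Fin.prod_univ_succ (n := H), Fin.castSucc_zero, Fin.cons_zero,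
    Fin.cons_succ, Fin.tail, ← Fin.succ_castSucc]

lemma pathReward_cons (r : Fin (H + 1) → S → A → ℝ) (π : Policy S A (H + 1)) (x : S)
    (τ : Fin (H + 1) → S) :
    pathReward r π (Fin.cons x τ) =
      r 0 x (π 0 x) + pathReward (Fin.tail r) (Fin.tail π) τ := by
  simp only [pathReward, Fin.sum_univ_succ (n := H), Fin.castSucc_zero, Fin.cons_zero,
    Fin.cons_succ, Fin.tail, ← Fin.succ_castSucc]

variable [Fintype S]

/-- The value of following `π` under `p` from stage `h` on, defined by backward induction. -/
def stageValue (r : Fin H → S → A → ℝ) (p : Transition S A H) (π : Policy S A H) :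
    Fin (H + 1) → S → ℝ :=
  Fin.reverseInduction (motive := fun _ => S → ℝ) 0
    (fun h V x => r h x (π h x) + ∑ y, p h x (π h x) y * V y)

lemma stageValue_last (r : Fin H → S → A → ℝ) (p : Transition S A H) (π : Policy S A H) :
    stageValue r p π (Fin.last H) = 0 := by
  simp [stageValue]

lemma stageValue_castSucc (r : Fin H → S → A → ℝ) (p : Transition S A H) (π : Policy S A H)
    (h : Fin H) (x : S) :
    stageValue r p π h.castSucc x =
      r h x (π h x) + ∑ y, p h x (π h x) y * stageValue r p π h.succ y := by
  simp [stageValue]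

lemma stageValue_succ (r : Fin (H + 1) → S → A → ℝ) (p : Transition S A (H + 1))
    (π : Policy S A (H + 1)) (h : Fin (H + 1)) :
    stageValue r p π h.succ = stageValue (Fin.tail r) (Fin.tail p) (Fin.tail π) h := by
  induction h using Fin.reverseInduction with
  | last => rw [Fin.succ_last, stageValue_last, stageValue_last]
  | cast h ih =>
    ext x
    rw [Fin.succ_castSucc, stageValue_castSucc, stageValue_castSucc, ih]
    rfl

lemma sum_paths_succ (F : (Fin (H + 2) → S) → ℝ) (x : S) :
    (∑ τ : Fin (H + 2) → S, if τ 0 = x then F τ else 0) =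
      ∑ τ : Fin (H + 1) → S, F (Fin.cons x τ) := by
  rw [← (Fin.consEquiv (fun _ : Fin (H + 2) => S)).sum_comp, Fintype.sum_prod_type]
  simp only [Fin.consEquiv_apply, Fin.cons_zero]
  rw [Finset.sum_comm]
  simp only [Finset.sum_ite_eq', Finset.mem_univ, if_true]
  rfl

lemma sum_paths_fiber (F : (Fin (H + 1) → S) → ℝ) :
    ∑ τ, F τ = ∑ y, ∑ τ : Fin (H + 1) → S, if τ 0 = y then F τ else 0 := by
  rw [Finset.sum_comm]
  simp

lemma sum_pathProb (p : Transition S A H) (hp : ∀ h x a, p h x a ∈ stdSimplex ℝ S)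
    (π : Policy S A H) (x : S) :
    (∑ τ : Fin (H + 1) → S, if τ 0 = x then pathProb p π τ else 0) = 1 := by
  induction H generalizing x with
  | zero =>
    rw [← (Equiv.funUnique (Fin 1) S).symm.sum_comp]
    simp [pathProb]
  | succ H ih =>
    rw [sum_paths_succ, sum_paths_fiber]
    simp_rw [pathProb_cons]
    rw [← (hp 0 x (π 0 x)).2]
    refine Finset.sum_congr rfl fun y _ => ?_
    rw [← mul_one (p 0 x (π 0 x) y), ← ih (Fin.tail p) (fun h => hp h.succ) (Fin.tail π) y,
      Finset.mul_sum]
    refine Finset.sum_congr rfl fun τ _ => ?_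
    split_ifs with h
    · rw [h]
    · simp

/-- Splitting a path after its first step turns the path sum into the Bellman recursion.
Stochasticity of `p` matters: the immediate reward is weighted by the total mass of all
continuations. -/
lemma valueFn_eq_stageValue (r : Fin H → S → A → ℝ) (p : Transition S A H)
    (hp : ∀ h x a, p h x a ∈ stdSimplex ℝ S) (π : Policy S A H) (x : S) :
    valueFn r p π x = stageValue r p π 0 x := by
  induction H generalizing x with
  | zero =>
    have : (0 : Fin 1) = Fin.last 0 := rfl
    rw [this, stageValue_last]
    simp [valueFn, pathReward]
  | succ H ih =>
    have hs : ∑ y, p 0 x (π 0 x) y = 1 := (hp 0 x (π 0 x)).2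
    rw [← Fin.castSucc_zero, stageValue_castSucc, stageValue_succ, valueFn, sum_paths_succ,
      sum_paths_fiber]
    rw [← mul_one (r 0 x (π 0 x)), ← hs, Finset.mul_sum, ← Finset.sum_add_distrib]
    refine Finset.sum_congr rfl fun y _ => ?_
    have h1 := sum_pathProb (Fin.tail p) (fun h => hp h.succ) (Fin.tail π) y
    rw [← ih (Fin.tail r) (Fin.tail p) (fun h => hp h.succ) (Fin.tail π) y, valueFn]
    calc _ = ∑ τ : Fin (H + 1) → S, (r 0 x (π 0 x) * p 0 x (π 0 x) y *
          (if τ 0 = y then pathProb (Fin.tail p) (Fin.tail π) τ else 0) +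
          p 0 x (π 0 x) y * (if τ 0 = y then pathProb (Fin.tail p) (Fin.tail π) τ *
            pathReward (Fin.tail r) (Fin.tail π) τ else 0)) := by
          refine Finset.sum_congr rfl fun τ _ => ?_
          split_ifs with h
          · rw [pathProb_cons, pathReward_cons, h]; ring
          · simp
      _ = _ := by
          rw [Finset.sum_add_distrib, ← Finset.mul_sum, ← Finset.mul_sum, h1, mul_one]

lemma stageValue_mem_Icc (r : Fin H → S → A → ℝ) (hr : ∀ h x a, r h x a ∈ Set.Icc (0 : ℝ) 1)
    (p : Transition S A H) (hp : ∀ h x a, p h x a ∈ stdSimplex ℝ S) (π : Policy S A H)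
    (h : Fin (H + 1)) (x : S) : stageValue r p π h x ∈ Set.Icc (0 : ℝ) H := by
  -- Bounding by the number of remaining stages makes the backward induction close.
  suffices 0 ≤ stageValue r p π h x ∧ stageValue r p π h x ≤ (H : ℝ) - (h : ℕ) by
    refine ⟨this.1, this.2.trans ?_⟩
    have : (0 : ℝ) ≤ ((h : ℕ) : ℝ) := Nat.cast_nonneg _
    linarith
  induction h using Fin.reverseInduction generalizing x with
  | last => rw [stageValue_last]; simp
  | cast h ih =>
    rw [stageValue_castSucc]
    have hp' := hp h x (π h x)
    have hr' := hr h x (π h x)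
    refine ⟨add_nonneg hr'.1 (Finset.sum_nonneg fun y _ => mul_nonneg (hp'.1 y) (ih y).1), ?_⟩
    have : ∑ y, p h x (π h x) y * stageValue r p π h.succ y ≤
        ∑ y, p h x (π h x) y * ((H : ℝ) - (h.succ : ℕ)) :=
      Finset.sum_le_sum fun y _ => mul_le_mul_of_nonneg_left (ih y).2 (hp'.1 y)
    rw [← Finset.sum_mul, hp'.2, one_mul] at this
    have h2 := hr'.2
    simp only [Fin.val_succ, Nat.cast_add, Nat.cast_one, Fin.val_castSucc] at this ⊢
    linarith

lemma valueFn_mem_Icc (r : Fin H → S → A → ℝ) (hr : ∀ h x a, r h x a ∈ Set.Icc (0 : ℝ) 1)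
    (p : Transition S A H) (hp : ∀ h x a, p h x a ∈ stdSimplex ℝ S) (π : Policy S A H)
    (x : S) : valueFn r p π x ∈ Set.Icc (0 : ℝ) H := by
  rw [valueFn_eq_stageValue r p hp]
  exact stageValue_mem_Icc r hr p hp π 0 x

/-- Simulation lemma along a trajectory: the difference of the values of `π` under `p` and `q` is
a sum of one-step model errors and of one-step deviations from the mean under `q`. -/
lemma valueFn_sub_valueFn (r : Fin H → S → A → ℝ) (p q : Transition S A H)
    (hp : ∀ h x a, p h x a ∈ stdSimplex ℝ S) (hq : ∀ h x a, q h x a ∈ stdSimplex ℝ S)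
    (π : Policy S A H) (τ : Fin (H + 1) → S) (D : Fin (H + 1) → S → ℝ)
    (hD : ∀ h x, D h x = stageValue r p π h x - stageValue r q π h x) :
    valueFn r p π (τ 0) - valueFn r q π (τ 0) =
      ∑ h : Fin H,
        ((∑ y, (p h (τ h.castSucc) (π h (τ h.castSucc)) y
            - q h (τ h.castSucc) (π h (τ h.castSucc)) y) * stageValue r p π h.succ y)
          + (∑ y, q h (τ h.castSucc) (π h (τ h.castSucc)) y * D h.succ y
            - D h.succ (τ h.succ))) := by
  have key : ∀ h : Fin H, D h.castSucc (τ h.castSucc) - D h.succ (τ h.succ) =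
      ((∑ y, (p h (τ h.castSucc) (π h (τ h.castSucc)) y
            - q h (τ h.castSucc) (π h (τ h.castSucc)) y) * stageValue r p π h.succ y)
          + (∑ y, q h (τ h.castSucc) (π h (τ h.castSucc)) y * D h.succ y
            - D h.succ (τ h.succ))) := by
    intro h
    rw [hD h.castSucc, stageValue_castSucc, stageValue_castSucc]
    simp only [hD, sub_mul, mul_sub, Finset.sum_sub_distrib]
    ring
  rw [← Finset.sum_congr rfl fun h _ => key h, Finset.sum_sub_distrib]
  -- Telescoping: one sum over all stages is split both at its first and at its last index, and the
  -- last gap is zero.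
  have h1 := Fin.sum_univ_castSucc (fun i : Fin (H + 1) => D i (τ i))
  rw [Fin.sum_univ_succ] at h1
  have h2 : D (Fin.last H) (τ (Fin.last H)) = 0 := by simp [hD, stageValue_last]
  rw [valueFn_eq_stageValue r p hp, valueFn_eq_stageValue r q hq, ← hD]
  linarith

/-- Integrating a function with values in `[0, B]` against two probability vectors. -/
lemma sum_sub_mul_le {p q V : S → ℝ} {B : ℝ} (hp : p ∈ stdSimplex ℝ S) (hq : q ∈ stdSimplex ℝ S)
    (hV : ∀ y, V y ∈ Set.Icc 0 B) :
    ∑ y, (p y - q y) * V y ≤ B / 2 * ∑ y, |p y - q y| ∧ ∑ y, (p y - q y) * V y ≤ B := by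
  constructor
  -- Both vectors have mass one, so `V` may be centred at `B / 2`; this saves the factor two later
  -- lost to the triangle inequality.
  · have h0 : ∑ y, (p y - q y) * V y = ∑ y, (p y - q y) * (V y - B / 2) := by
      simp only [mul_sub, Finset.sum_sub_distrib, ← Finset.sum_mul, hp.2, hq.2]
      simp
    rw [h0, Finset.mul_sum]
    refine Finset.sum_le_sum fun y _ => ?_
    refine (le_abs_self _).trans ?_
    rw [abs_mul, mul_comm]
    refine mul_le_mul_of_nonneg_right ?_ (abs_nonneg _)
    rw [abs_le]
    have := hV y
    constructor <;> linarith [this.1, this.2]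
  · have h1 : ∑ y, p y * V y ≤ ∑ y, p y * B :=
      Finset.sum_le_sum fun y _ => mul_le_mul_of_nonneg_left (hV y).2 (hp.1 y)
    have h2 : 0 ≤ ∑ y, q y * V y :=
      Finset.sum_nonneg fun y _ => mul_nonneg (hq.1 y) (hV y).1
    rw [← Finset.sum_mul, hp.2, one_mul] at h1
    simp only [sub_mul, Finset.sum_sub_distrib]
    linarith

end Planning

/-- Hoeffding's lemma for a probability vector. -/
lemma sum_mul_exp_le {S : Type*} [Fintype S] {p f : S → ℝ} (hp : p ∈ stdSimplex ℝ S) {B : ℝ}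
    (hf : ∀ y, |f y| ≤ B) (t : ℝ) :
    ∑ y, p y * Real.exp (t * (f y - ∑ z, p z * f z) - t ^ 2 * B ^ 2 / 2) ≤ 1 := by
  let _ : MeasurableSpace S := ⊤
  let P : PMF S := PMF.ofFintype (fun y => ENNReal.ofReal (p y)) (by
    rw [← ENNReal.ofReal_sum_of_nonneg fun y _ => hp.1 y, hp.2, ENNReal.ofReal_one])
  have hP : ∀ y, (P y).toReal = p y := fun y => ENNReal.toReal_ofReal (hp.1 y)
  have hint : ∀ g : S → ℝ, ∫ y, g y ∂P.toMeasure = ∑ y, p y * g y := fun g => by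
    rw [PMF.integral_eq_sum]
    simp only [hP, smul_eq_mul]
  have hmgf := (ProbabilityTheory.hasSubgaussianMGF_of_mem_Icc (μ := P.toMeasure) (X := f)
    (a := -B) (b := B) (measurable_of_finite f).aemeasurable
    (ae_of_all _ fun y => abs_le.1 (hf y))).mgf_le t
  rw [ProbabilityTheory.mgf, hint, hint] at hmgf
  have hc : (((‖B - -B‖₊ / 2) ^ 2 : NNReal) : ℝ) = B ^ 2 := by
    push_cast
    rw [Real.norm_eq_abs, div_pow, sq_abs]
    ring
  rw [hc] at hmgf
  simp_rw [Real.exp_sub, ← mul_div_assoc]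
  rw [← Finset.sum_div, div_le_one (Real.exp_pos _)]
  refine hmgf.trans (le_of_eq ?_)
  congr 1
  ring

/-! ### Finite records and dependence on the past. -/

section History

variable {S A : Type*} {H K : ℕ}

/-- A complete record of `K` episodes: the visited states and the policies. -/
abbrev History (S A : Type*) (H K : ℕ) :=
  (Fin K → Fin (H + 1) → S) × (Fin K → Policy S A H)

/-- The two records agree up to the choice of the action at stage `m.2` of episode `m.1`. -/
def Agree (m : Fin K × Fin H) (z z' : History S A H K) : Prop :=
  (∀ j < m.1, ∀ i, z.1 j i = z'.1 j i) ∧ (∀ i ≤ m.2.castSucc, z.1 m.1 i = z'.1 m.1 i) ∧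
    ∀ j ≤ m.1, z.2 j = z'.2 j

/-- `f` depends only on the record up to the choice of the action at stage `m.2` of episode
`m.1`. -/
def Adapted {β : Type*} (m : Fin K × Fin H) (f : History S A H K → β) : Prop :=
  ∀ z z', Agree m z z' → f z = f z'

/-- The next state after stage `m.2` of episode `m.1`. -/
def nextState (m : Fin K × Fin H) (z : History S A H K) : S := z.1 m.1 m.2.succ

/-- In lexicographic order of rounds, the past of a round determines both the past and the outcome
of every earlier round. Hence a product over earlier rounds is a function of the past. -/
lemma Agree.of_lt {m m' : Fin K ×ₗ Fin H} (hm : m' < m) {z z' : History S A H K}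
    (h : Agree (ofLex m) z z') :
    Agree (ofLex m') z z' ∧ nextState (ofLex m') z = nextState (ofLex m') z' := by
  rw [Prod.Lex.lt_iff] at hm
  obtain ⟨h1, h2, h3⟩ := h
  rcases hm with hm | ⟨hm, hm'⟩
  · exact ⟨⟨fun j hj => h1 j (hj.trans hm), fun i _ => h1 _ hm i,
      fun j hj => h3 j (hj.trans hm.le)⟩, h1 _ hm _⟩
  · refine ⟨⟨fun j hj => h1 j (hm ▸ hj), fun i hi => ?_, fun j hj => h3 j (hm ▸ hj)⟩, ?_⟩
    · rw [hm]
      exact h2 i (hi.trans (Fin.castSucc_le_castSucc_iff.2 hm'.le))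
    · rw [nextState, nextState, hm]
      exact h2 _ (Fin.succ_le_castSucc_iff.2 hm')

variable [Fintype S]

/-- The probability of moving to `y` after stage `m.2` of episode `m.1`. -/
def stepProb (M : EpisodicMDP S A H) (m : Fin K × Fin H) (z : History S A H K) (y : S) : ℝ :=
  M.trans (z.1 m.1 m.2.castSucc) (z.2 m.1 m.2 (z.1 m.1 m.2.castSucc)) y

lemma stepProb_mem (M : EpisodicMDP S A H) (m : Fin K × Fin H) (z : History S A H K) :
    stepProb M m z ∈ stdSimplex ℝ S := M.trans_mem _ _

lemma adapted_stepProb (M : EpisodicMDP S A H) (m : Fin K × Fin H) :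
    Adapted m (stepProb M m) := by
  rintro z z' ⟨-, h2, h3⟩
  ext y
  rw [stepProb, stepProb, h2 _ le_rfl, h3 _ le_rfl]

end History

/-! ### Exponential supermartingales and the Chernoff bound. -/

section Interaction

variable {S A Ω : Type*} [Fintype S] [Fintype A] {H K : ℕ} {mΩ : MeasurableSpace Ω}
  {M : EpisodicMDP S A H} {μ : Measure Ω} {ℱ : Filtration ℕ mΩ}
  {X : Fin K → Fin (H + 1) → Ω → S} {π : Fin K → Ω → Policy S A H}

/-- The record of the interaction. -/
def record (X : Fin K → Fin (H + 1) → Ω → S) (π : Fin K → Ω → Policy S A H) (ω : Ω) :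
    History S A H K := (fun k h => X k h ω, fun k => π k ω)

lemma measurable_record (hint : IsInteraction M μ ℱ X π) (f : History S A H K → ℝ) :
    Measurable fun ω => f (record X π ω) := by
  let _ : MeasurableSpace S := ⊤
  let _ : MeasurableSpace (Policy S A H) := ⊤
  refine (measurable_of_finite f).comp (Measurable.prodMk ?_ ?_)
  · refine measurable_pi_iff.2 fun j => measurable_pi_iff.2 fun i => ?_
    exact measurable_to_countable' fun x => ℱ.le _ _ (hint.state_meas j i x)
  · refine measurable_pi_iff.2 fun j => ?_
    exact measurable_to_countable' fun x => ℱ.le _ _ (hint.policy_meas j x)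

variable [IsProbabilityMeasure μ]

/-- Overwriting all later entries of the record by those of a fixed record leaves `f` unchanged.
What remains is a function on a finite type of entries already known at that time. -/
lemma measurable_adapted (hint : IsInteraction M μ ℱ X π) (m : Fin K × Fin H)
    (f : History S A H K → ℝ) (hf : Adapted m f) :
    Measurable[ℱ ((m.1 : ℕ) * (H + 1) + (m.2 : ℕ) + 1)] fun ω => f (record X π ω) := by
  obtain ⟨ω₀⟩ : Nonempty Ω := nonempty_of_isProbabilityMeasure μ
  let z₀ := record X π ω₀
  let mask : History S A H K → History S A H K := fun z =>
    (fun j i => if j < m.1 ∨ (j = m.1 ∧ i ≤ m.2.castSucc) then z.1 j i else z₀.1 j i,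
     fun j => if j ≤ m.1 then z.2 j else z₀.2 j)
  have hmask : ∀ z, f z = f (mask z) := fun z => hf _ _
    ⟨fun j hj i => by simp [mask, hj], fun i hi => by simp [mask, hi],
      fun j hj => by simp [mask, hj]⟩
  simp_rw [hmask (record X π _)]
  let _ : MeasurableSpace S := ⊤
  let _ : MeasurableSpace (Policy S A H) := ⊤
  let _ : MeasurableSpace Ω := ℱ ((m.1 : ℕ) * (H + 1) + (m.2 : ℕ) + 1)
  refine (measurable_of_finite f).comp (Measurable.prodMk ?_ ?_)
  · refine measurable_pi_iff.2 fun j => measurable_pi_iff.2 fun i => ?_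
    by_cases h : j < m.1 ∨ (j = m.1 ∧ i ≤ m.2.castSucc)
    · simp only [h, if_true]
      refine measurable_to_countable' fun x => ?_
      refine ℱ.mono ?_ _ (hint.state_meas j i x)
      have hi := i.isLt
      rcases h with h | ⟨rfl, h⟩
      · have : ((j : ℕ) + 1) * (H + 1) ≤ (m.1 : ℕ) * (H + 1) :=
          Nat.mul_le_mul_right _ (Fin.lt_def.1 h)
        rw [add_mul, one_mul] at this
        omega
      · rw [Fin.le_def, Fin.val_castSucc] at h
        omega
    · simp only [h, if_false]
      exact measurable_const
  · refine measurable_pi_iff.2 fun j => ?_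
    by_cases h : j ≤ m.1
    · simp only [h, if_true]
      refine measurable_to_countable' fun x => ?_
      refine ℱ.mono ?_ _ (hint.policy_meas j x)
      have : (j : ℕ) * (H + 1) ≤ (m.1 : ℕ) * (H + 1) := Nat.mul_le_mul_right _ (Fin.le_def.1 h)
      omega
    · simp only [h, if_false]
      exact measurable_const

lemma integrable_record (hint : IsInteraction M μ ℱ X π) (f : History S A H K → ℝ) :
    Integrable (fun ω => f (record X π ω)) μ := by
  refine Integrable.of_bound (measurable_record hint f).aestronglyMeasurable (∑ z, ‖f z‖)
    (ae_of_all _ fun ω => ?_)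
  exact Finset.single_le_sum (f := fun z => ‖f z‖) (fun z _ => norm_nonneg _) (Finset.mem_univ _)

/-- A transition drawn from its conditional law, weighted by a nonnegative function of the past. -/
lemma integral_mul_nextState_le (hint : IsInteraction M μ ℱ X π) (m : Fin K × Fin H)
    (G : History S A H K → ℝ) (hG : Adapted m G) (hG0 : ∀ z, 0 ≤ G z)
    (φ : History S A H K → S → ℝ) (hφ : Adapted m φ)
    (hφ1 : ∀ z, ∑ y, stepProb M m z y * φ z y ≤ 1) :
    ∫ ω, G (record X π ω) * φ (record X π ω) (nextState m (record X π ω)) ∂μ ≤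
      ∫ ω, G (record X π ω) ∂μ := by
  -- Decomposing over the value `y` of the next state leaves an indicator as the only unpredictable
  -- factor, so `trans_law` applies after pulling out the rest.
  have key : ∀ y : S,
      ∫ ω, G (record X π ω) * φ (record X π ω) y *
        (if nextState m (record X π ω) = y then 1 else 0) ∂μ =
      ∫ ω, G (record X π ω) * φ (record X π ω) y * stepProb M m (record X π ω) y ∂μ := by
    intro y
    have hle := ℱ.le ((m.1 : ℕ) * (H + 1) + (m.2 : ℕ) + 1)
    have hmeas := measurable_adapted hint m (fun z => G z * φ z y)
      fun z z' h => by simp only [hG z z' h, hφ z z' h]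
    have hpull := condExp_mul_of_stronglyMeasurable_left (μ := μ)
      (g := fun ω => if X m.1 m.2.succ ω = y then (1 : ℝ) else 0) hmeas.stronglyMeasurable
      (integrable_record hint
        (fun z => G z * φ z y * (if nextState m z = y then 1 else 0)))
      (integrable_record hint (fun z => if nextState m z = y then 1 else 0))
    have h1 := integral_condExp (μ := μ) (f := fun ω => G (record X π ω) * φ (record X π ω) y *
        (if nextState m (record X π ω) = y then 1 else 0)) hle
    rw [← h1]
    refine integral_congr_ae ?_
    filter_upwards [hpull, hint.trans_law m.1 m.2 y] with ω h2 h3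
    exact h2.trans (congrArg _ h3)
  calc _ = ∫ ω, ∑ y, G (record X π ω) * φ (record X π ω) y *
        (if nextState m (record X π ω) = y then 1 else 0) ∂μ := by
        refine integral_congr_ae (ae_of_all _ fun ω => ?_)
        simp
    _ = ∑ y, ∫ ω, G (record X π ω) * φ (record X π ω) y * stepProb M m (record X π ω) y ∂μ := by
        rw [integral_finsetSum _ fun y _ => integrable_record hint
          (fun z => G z * φ z y * (if nextState m z = y then 1 else 0))]
        exact Finset.sum_congr rfl fun y _ => key y
    _ = ∫ ω, ∑ y, G (record X π ω) * φ (record X π ω) y * stepProb M m (record X π ω) y ∂μ :=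
        (integral_finsetSum _ fun y _ => integrable_record hint
          (fun z => G z * φ z y * stepProb M m z y)).symm
    _ ≤ _ := by
        refine integral_mono (integrable_record hint
          (fun z => ∑ y, G z * φ z y * stepProb M m z y)) (integrable_record hint G) fun ω => ?_
        have := mul_le_mul_of_nonneg_left (hφ1 (record X π ω)) (hG0 (record X π ω))
        rw [mul_one, Finset.mul_sum] at this
        refine le_trans (le_of_eq (Finset.sum_congr rfl fun y _ => ?_)) this
        ring

/-- A product of one-step factors with conditional means at most one has mean at most one. -/
lemma integral_prod_nextState_le_one (hint : IsInteraction M μ ℱ X π)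
    (φ : Fin K × Fin H → History S A H K → S → ℝ) (hφ : ∀ m, Adapted m (φ m))
    (hφ0 : ∀ m z y, 0 ≤ φ m z y) (hφ1 : ∀ m z, ∑ y, stepProb M m z y * φ m z y ≤ 1) :
    ∫ ω, ∏ m, φ m (record X π ω) (nextState m (record X π ω)) ∂μ ≤ 1 := by
  -- The induction removes the latest round first, so the remaining product is known when that round
  -- is drawn.
  suffices ∀ s : Finset (Fin K ×ₗ Fin H),
      ∫ ω, ∏ m ∈ s, φ (ofLex m) (record X π ω) (nextState (ofLex m) (record X π ω)) ∂μ ≤ 1 from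
    this Finset.univ
  intro s
  induction s using Finset.induction_on_max with
  | empty => simp
  | insert a s hs ih =>
    have ha : a ∉ s := fun h => lt_irrefl _ (hs a h)
    simp_rw [Finset.prod_insert ha, mul_comm (φ (ofLex a) _ _)]
    refine (integral_mul_nextState_le hint (ofLex a)
      (fun z => ∏ m ∈ s, φ (ofLex m) z (nextState (ofLex m) z)) (fun z z' h => ?_)
      (fun z => Finset.prod_nonneg fun m _ => hφ0 _ _ _) (φ (ofLex a)) (hφ _) (hφ1 _)).trans ih
    refine Finset.prod_congr rfl fun m hm => ?_
    obtain ⟨h1, h2⟩ := h.of_lt (hs m hm)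
    rw [hφ _ _ _ h1, h2]

/-- Chernoff bound for a sum of increments with conditional exponential moments. -/
lemma measureReal_le_exp_neg (hint : IsInteraction M μ ℱ X π)
    (ψ : Fin K × Fin H → History S A H K → S → ℝ) (hψ : ∀ m, Adapted m (ψ m))
    (hψ1 : ∀ m z, ∑ y, stepProb M m z y * Real.exp (ψ m z y) ≤ 1) (u : ℝ) :
    μ.real {ω | u ≤ ∑ m, ψ m (record X π ω) (nextState m (record X π ω))} ≤ Real.exp (-u) := by
  have h1 := integral_prod_nextState_le_one hint (fun m z y => Real.exp (ψ m z y))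
    (fun m z z' h => by simp only [hψ m z z' h]) (fun m z y => (Real.exp_pos _).le) hψ1
  simp_rw [← Real.exp_sum] at h1
  have h2 := mul_meas_ge_le_integral_of_nonneg (μ := μ)
    (f := fun ω => Real.exp (∑ m, ψ m (record X π ω) (nextState m (record X π ω))))
    (ae_of_all _ fun ω => (Real.exp_pos _).le)
    (integrable_record hint fun z => Real.exp (∑ m, ψ m z (nextState m z))) (Real.exp u)
  simp_rw [Real.exp_le_exp] at h2
  rw [Real.exp_neg, ← one_div, le_div_iff₀' (Real.exp_pos u)]
  exact h2.trans h1

end Interaction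

/-! ### Visit counts as functions of the record. -/

section Counts

variable {S A : Type*} {H K : ℕ}

lemma visits_eq_of_agree {m : Fin K × Fin H} {z z' : History S A H K} (h : Agree m z z') :
    visits z.1 z.2 m.1 = visits z'.1 z'.2 m.1 := by
  ext x a
  refine Finset.sum_congr rfl fun j hj => Finset.sum_congr rfl fun i _ => ?_
  rw [Finset.mem_Iio] at hj
  rw [h.1 j hj, h.2.2 j hj.le]

lemma transVisits_eq_of_agree {m : Fin K × Fin H} {z z' : History S A H K} (h : Agree m z z') :
    transVisits z.1 z.2 m.1 = transVisits z'.1 z'.2 m.1 := by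
  ext x a y
  refine Finset.sum_congr rfl fun j hj => Finset.sum_congr rfl fun i _ => ?_
  rw [Finset.mem_Iio] at hj
  rw [h.1 j hj, h.1 j hj, h.2.2 j hj.le]

lemma visits_le (s : Fin K → Fin (H + 1) → S) (π : Fin K → Policy S A H) (k : Fin K)
    (x : S) (a : A) : visits s π k x a ≤ K * H := by
  calc visits s π k x a ≤ ∑ j ∈ Finset.Iio k, ∑ _h : Fin H, 1 := by
        unfold visits
        gcongr
        split_ifs <;> simp
    _ ≤ K * H := by
        simp only [Finset.sum_const, Finset.card_univ, Fintype.card_fin, smul_eq_mul, mul_one,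
          Fin.card_Iio]
        gcongr
        exact k.isLt.le

variable [Fintype S]

lemma sum_mul_transVisits (s : Fin K → Fin (H + 1) → S) (π : Fin K → Policy S A H) (k : Fin K)
    (x : S) (a : A) (v : S → ℝ) :
    ∑ y, v y * (transVisits s π k x a y : ℝ) =
      ∑ j ∈ Finset.Iio k, ∑ h : Fin H,
        if s j h.castSucc = x ∧ π j h (s j h.castSucc) = a then v (s j h.succ) else 0 := by
  simp only [transVisits, Nat.cast_sum, Finset.mul_sum]
  rw [Finset.sum_comm]
  refine Finset.sum_congr rfl fun j _ => ?_
  rw [Finset.sum_comm]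
  refine Finset.sum_congr rfl fun h _ => ?_
  by_cases hx : s j h.castSucc = x ∧ π j h (s j h.castSucc) = a
  · have h1 : ∀ y, (s j h.castSucc = x ∧ π j h (s j h.castSucc) = a ∧ s j h.succ = y) ↔
        s j h.succ = y := fun y => ⟨fun h => h.2.2, fun h => ⟨hx.1, hx.2, h⟩⟩
    rw [if_pos hx]
    simp [h1]
  · rw [if_neg hx]
    simp [← and_assoc, hx]

variable [Fintype A]

lemma plausible_eq_of_agree (c δ : ℝ) {m : Fin K × Fin H} {z z' : History S A H K}
    (h : Agree m z z') : plausible c δ z.1 z.2 m.1 = plausible c δ z'.1 z'.2 m.1 := by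
  simp only [plausible, empTrans, width, visits_eq_of_agree h, transVisits_eq_of_agree h]

end Counts

/-! ### Deviation bounds for transition counts and for value gaps. -/

section Concentration

variable {S A Ω : Type*} [Fintype S] [Fintype A] {H K : ℕ} {mΩ : MeasurableSpace Ω}
  {M : EpisodicMDP S A H} {μ : Measure Ω} [IsProbabilityMeasure μ] {ℱ : Filtration ℕ mΩ}
  {X : Fin K → Fin (H + 1) → Ω → S} {π : Fin K → Ω → Policy S A H}

/-- Chernoff bound for the deviation of the observed transitions from `(x, a)`, tested against
`v`. -/
lemma measureReal_transVisits_le (hint : IsInteraction M μ ℱ X π) (k : Fin K) (x : S) (a : A)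
    (v : S → ℝ) (hv : ∀ y, |v y| ≤ 1) (t u : ℝ) :
    μ.real {ω | u ≤ t * (∑ y, v y * (transVisits (record X π ω).1 (record X π ω).2 k x a y : ℝ)
        - visits (record X π ω).1 (record X π ω).2 k x a * ∑ y, M.trans x a y * v y)
        - visits (record X π ω).1 (record X π ω).2 k x a * (t ^ 2 / 2)} ≤ Real.exp (-u) := by
  set w := ∑ y, M.trans x a y * v y
  -- Rounds that do not count for `(x, a)` before episode `k` contribute zero, so the variance
  -- correction is multiplied by the random visit count itself.
  let ψ : Fin K × Fin H → History S A H K → S → ℝ := fun m z y =>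
    if m.1 < k ∧ z.1 m.1 m.2.castSucc = x ∧ z.2 m.1 m.2 (z.1 m.1 m.2.castSucc) = a then
      t * (v y - w) - t ^ 2 * 1 ^ 2 / 2 else 0
  have hψ : ∀ m, Adapted m (ψ m) := by
    rintro m z z' ⟨-, h2, h3⟩
    ext y
    simp only [ψ, h2 _ le_rfl, h3 _ le_rfl]
  have hψ1 : ∀ m z, ∑ y, stepProb M m z y * Real.exp (ψ m z y) ≤ 1 := by
    intro m z
    by_cases h : m.1 < k ∧ z.1 m.1 m.2.castSucc = x ∧ z.2 m.1 m.2 (z.1 m.1 m.2.castSucc) = a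
    · simp only [ψ, if_pos h, stepProb]
      rw [h.2.2, h.2.1]
      exact sum_mul_exp_le (M.trans_mem x a) hv t
    · simp only [ψ, if_neg h, Real.exp_zero, mul_one]
      exact (stepProb_mem M m z).2.le
  have hsum : ∀ z : History S A H K, ∑ m, ψ m z (nextState m z) =
      t * (∑ y, v y * (transVisits z.1 z.2 k x a y : ℝ)
        - visits z.1 z.2 k x a * w)
        - visits z.1 z.2 k x a * (t ^ 2 / 2) := by
    intro z
    rw [sum_mul_transVisits, visits, Fintype.sum_prod_type]
    have hk : (Finset.Iio k) = Finset.univ.filter (· < k) := by ext; simp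
    have hterm : ∀ j h, ψ (j, h) z (nextState (j, h) z) = if j < k then
        t * ((if z.1 j h.castSucc = x ∧ z.2 j h (z.1 j h.castSucc) = a then
            v (z.1 j h.succ) else 0)
          - ((if z.1 j h.castSucc = x ∧ z.2 j h (z.1 j h.castSucc) = a then 1 else 0 : ℕ) : ℝ)
            * w)
          - ((if z.1 j h.castSucc = x ∧ z.2 j h (z.1 j h.castSucc) = a then 1 else 0 : ℕ) : ℝ)
            * (t ^ 2 / 2) else 0 := by
      intro j h
      by_cases hj : j < k
      · by_cases hx : z.1 j h.castSucc = x ∧ z.2 j h (z.1 j h.castSucc) = a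
        · simp only [ψ, nextState, if_pos hj, if_pos hx, if_pos (And.intro hj hx)]
          push_cast
          ring
        · simp [ψ, hx]
      · simp [ψ, hj]
    simp only [hterm]
    calc _ = ∑ j ∈ Finset.Iio k, ∑ h : Fin H, (t * ((if z.1 j h.castSucc = x ∧
            z.2 j h (z.1 j h.castSucc) = a then v (z.1 j h.succ) else 0)
          - ((if z.1 j h.castSucc = x ∧ z.2 j h (z.1 j h.castSucc) = a then 1 else 0 : ℕ) : ℝ)
            * w)
          - ((if z.1 j h.castSucc = x ∧ z.2 j h (z.1 j h.castSucc) = a then 1 else 0 : ℕ) : ℝ)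
            * (t ^ 2 / 2)) := by
          rw [hk, Finset.sum_filter]
          refine Finset.sum_congr rfl fun j _ => ?_
          split_ifs <;> simp
      _ = _ := by
          simp only [Nat.cast_sum, Finset.sum_sub_distrib, ← Finset.mul_sum, ← Finset.sum_mul]
  have := measureReal_le_exp_neg hint ψ hψ hψ1 u
  simp_rw [hsum] at this
  exact this

/-- Azuma's inequality for one-step deviations of a bounded function chosen from the past. -/
lemma measureReal_deviation_le (hint : IsInteraction M μ ℱ X π) (hH : 0 < H) (hK : 0 < K)
    {δ : ℝ} (hδ : δ ∈ Set.Ioo (0 : ℝ) 1)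
    (D : History S A H K → Fin K → Fin (H + 1) → S → ℝ)
    (hD : ∀ m : Fin K × Fin H, Adapted m (fun z => D z m.1))
    (hDB : ∀ z k h y, |D z k h y| ≤ H) :
    μ.real {ω | (H : ℝ) * √(2 * ((K : ℝ) * H) * Real.log (1 / δ)) ≤
      ∑ m : Fin K × Fin H,
        (∑ y, stepProb M m (record X π ω) y * D (record X π ω) m.1 m.2.succ y
          - D (record X π ω) m.1 m.2.succ (nextState m (record X π ω)))} ≤ δ := by
  have hH' : (0 : ℝ) < H := by exact_mod_cast hH
  have hK' : (0 : ℝ) < K := by exact_mod_cast hK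
  have hl : 0 ≤ Real.log (1 / δ) := Real.log_nonneg (by
    rw [le_div_iff₀ hδ.1]; linarith [hδ.2])
  set ℓ := Real.log (1 / δ) with hℓ
  set T : ℝ := (K : ℝ) * H with hT
  have hT0 : 0 < T := mul_pos hK' hH'
  set s := √(2 * T * ℓ) with hs
  have hs0 : 0 ≤ s := Real.sqrt_nonneg _
  have hs2 : s ^ 2 = 2 * T * ℓ := Real.sq_sqrt (by positivity)
  -- The optimal Chernoff parameter: the linear part becomes `2 * ℓ` and the variance correction
  -- `ℓ`.
  set t := s / (T * H) with ht
  have ht0 : 0 ≤ t := by positivity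
  have key := measureReal_le_exp_neg hint
    (fun m z y => t * ((fun y => - D z m.1 m.2.succ y) y
      - ∑ y, stepProb M m z y * (fun y => - D z m.1 m.2.succ y) y) - t ^ 2 * (H : ℝ) ^ 2 / 2)
    (fun m z z' h => by
      have h1 := hD m z z' h
      simp only at h1
      simp only [h1, adapted_stepProb M m z z' h])
    (fun m z => sum_mul_exp_le (stepProb_mem M m z) (fun y => by
      rw [abs_neg]; exact hDB _ _ _ _) t) ℓ
  have hδe : Real.exp (-ℓ) = δ := by
    rw [hℓ, one_div, Real.log_inv, neg_neg, Real.exp_log hδ.1]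
  rw [hδe] at key
  refine (measureReal_mono fun ω hω => ?_).trans key
  rw [Set.mem_ofPred_eq] at hω ⊢
  have h1 := mul_le_mul_of_nonneg_left hω ht0
  have h2 : t * (H * s) = 2 * ℓ := by
    rw [ht]; field_simp; rw [hs2]; ring
  have h3 : T * (t ^ 2 * (H : ℝ) ^ 2 / 2) = ℓ := by
    rw [ht]; field_simp; rw [hs2]; ring
  rw [h2] at h1
  rw [Finset.sum_sub_distrib, Finset.sum_const, ← Finset.mul_sum]
  simp only [Finset.card_univ, Fintype.card_prod, Fintype.card_fin, nsmul_eq_mul, Nat.cast_mul,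
    mul_neg, Finset.sum_neg_distrib, neg_sub_neg]
  rw [← hT, h3]
  linarith

end Concentration

/-! ### Sign vectors and the union bound. -/

/-- The sign vector of a set of states. -/
def signVec {S : Type*} (B : Finset S) (y : S) : ℝ := if y ∈ B then 1 else -1

lemma abs_signVec_le {S : Type*} (B : Finset S) (y : S) : |signVec B y| ≤ 1 := by
  unfold signVec
  split_ifs <;> simp

lemma exists_sum_signVec {S : Type*} [Fintype S] (f : S → ℝ) :
    ∃ B : Finset S, ∑ y, |f y| = ∑ y, signVec B y * f y := by
  refine ⟨Finset.univ.filter fun y => 0 ≤ f y, Finset.sum_congr rfl fun y _ => ?_⟩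
  unfold signVec
  by_cases h : 0 ≤ f y
  · simp [h, abs_of_nonneg]
  · simp [h, abs_of_neg (not_le.1 h)]

/-- The union bound over episodes, state-action pairs, sign vectors and visit counts. -/
lemma union_bound_le {s a k h : ℕ} (hs : 0 < s) (ha : 0 < a) (hk : 0 < k) (hh : 0 < h)
    {δ c : ℝ} (hδ : δ ∈ Set.Ioo (0 : ℝ) 1) (hc : 4 ≤ c) :
    (k * (s * (a * (2 ^ s * (k * h : ℕ)))) : ℝ) *
      Real.exp (-(c * s * Real.log (2 * s * a * ((k : ℝ) * h) / δ) / 2)) ≤ δ := by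
  obtain ⟨n, rfl⟩ : ∃ n, s = n + 1 := ⟨s - 1, by omega⟩
  have hs1 : (1 : ℝ) ≤ ((n + 1 : ℕ) : ℝ) := by exact_mod_cast hs
  have ha1 : (1 : ℝ) ≤ a := by exact_mod_cast ha
  have hk1 : (1 : ℝ) ≤ k := by exact_mod_cast hk
  have hh1 : (1 : ℝ) ≤ h := by exact_mod_cast hh
  set σ : ℝ := ((n + 1 : ℕ) : ℝ) with hσ
  have hprod : (1 : ℝ) ≤ σ * a * ((k : ℝ) * h) := by
    have h1 := one_le_mul_of_one_le_of_one_le hs1 ha1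
    have h2 := one_le_mul_of_one_le_of_one_le hk1 hh1
    exact one_le_mul_of_one_le_of_one_le h1 h2
  set W : ℝ := σ * a * ((k : ℝ) * h) with hW
  have hδ0 := hδ.1
  have hδ1 := hδ.2
  have harg : 2 * σ * a * ((k : ℝ) * h) / δ = (δ / (2 * W))⁻¹ := by
    rw [inv_div, hW]; ring
  have hq0 : 0 < δ / (2 * W) := by positivity
  have hq1 : δ / (2 * W) ≤ 1 / 2 := by
    rw [div_le_div_iff₀ (by positivity) (by norm_num)]; linarith
  set q := δ / (2 * W) with hq
  rw [harg, Real.log_inv]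
  have hlog : Real.log q ≤ 0 := Real.log_nonpos hq0.le (by linarith)
  -- Here `c ≥ 4` gives the exponent `2 * s`: one factor `q ^ 2` pays for `W ^ 2`, and the others,
  -- each at most `1 / 4`, beat the `2 ^ s` sign vectors.
  have hexp : Real.exp (-(c * σ * -Real.log q / 2)) ≤ q ^ (2 * (n + 1)) := by
    rw [← Real.exp_log (pow_pos hq0 (2 * (n + 1))), Real.exp_le_exp, Real.log_pow]
    have : σ * Real.log q * (c - 4) ≤ 0 :=
      mul_nonpos_of_nonpos_of_nonneg (mul_nonpos_of_nonneg_of_nonpos (by linarith) hlog)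
        (by linarith)
    have h2 : ((2 * (n + 1) : ℕ) : ℝ) = 2 * σ := by rw [hσ]; push_cast; ring
    rw [h2]
    linarith
  have hpow : q ^ (2 * (n + 1)) ≤ q ^ 2 * (1 / 4) ^ n := by
    rw [mul_add, pow_add, mul_one, mul_comm, pow_mul]
    gcongr
    calc q ^ 2 ≤ (1 / 2) ^ 2 := by gcongr
      _ = 1 / 4 := by norm_num
  have hcount : (k : ℝ) * (σ * (a * (2 ^ (n + 1) * (k * h : ℕ)))) ≤ W ^ 2 * 2 ^ (n + 1) := by
    push_cast
    have h1 : (k : ℝ) ≤ W := by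
      have := one_le_mul_of_one_le_of_one_le (one_le_mul_of_one_le_of_one_le hs1 ha1) hh1
      calc (k : ℝ) = 1 * k := by ring
        _ ≤ (σ * a * h) * k := by gcongr
        _ = W := by rw [hW]; ring
    calc (k : ℝ) * (σ * (a * (2 ^ (n + 1) * (k * h)))) = k * W * 2 ^ (n + 1) := by rw [hW]; ring
      _ ≤ W * W * 2 ^ (n + 1) := by gcongr
      _ = _ := by ring
  calc _ ≤ (W ^ 2 * 2 ^ (n + 1)) * (q ^ 2 * (1 / 4) ^ n) := by
        refine mul_le_mul hcount (hexp.trans hpow) (Real.exp_pos _).le (by positivity)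
    _ = (W * q) ^ 2 * 2 * (2 ^ n * (1 / 4) ^ n) := by ring
    _ = (δ / 2) ^ 2 * 2 * (1 / 2) ^ n := by
        rw [← mul_pow, hq]
        congr 2
        · congr 1
          have : W ≠ 0 := by positivity
          field_simp
        · norm_num
    _ ≤ (δ / 2) ^ 2 * 2 * 1 := by
        gcongr
        exact pow_le_one₀ (by norm_num) (by norm_num)
    _ ≤ δ := by nlinarith

/-! ### The true model is plausible in every episode. -/

section ConfidenceSet

variable {S A Ω : Type*} [Fintype S] [Fintype A] {H K : ℕ} {mΩ : MeasurableSpace Ω}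
  {M : EpisodicMDP S A H} {μ : Measure Ω} [IsProbabilityMeasure μ] {ℱ : Filtration ℕ mΩ}
  {X : Fin K → Fin (H + 1) → Ω → S} {π : Fin K → Ω → Policy S A H}

lemma log_two_le_logFactor [Nonempty S] [Nonempty A] (hH : 0 < H) (hK : 0 < K) {δ : ℝ}
    (hδ : δ ∈ Set.Ioo (0 : ℝ) 1) : Real.log 2 ≤ logFactor S A H K δ := by
  have hs1 : (1 : ℝ) ≤ Fintype.card S := by exact_mod_cast Fintype.card_pos
  have ha1 : (1 : ℝ) ≤ Fintype.card A := by exact_mod_cast Fintype.card_pos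
  have hk1 : (1 : ℝ) ≤ K := by exact_mod_cast hK
  have hh1 : (1 : ℝ) ≤ H := by exact_mod_cast hH
  refine Real.log_le_log (by norm_num) ?_
  rw [le_div_iff₀ hδ.1]
  have := one_le_mul_of_one_le_of_one_le (one_le_mul_of_one_le_of_one_le hs1 ha1)
    (one_le_mul_of_one_le_of_one_le hk1 hh1)
  nlinarith [hδ.2]

/-- Holds since `4 * log 2 > 1`. It makes the width at unvisited pairs at least one and lets
`regret_term_le` absorb the lower-order term. -/
lemma one_le_mul_logFactor [Nonempty S] [Nonempty A] (hH : 0 < H) (hK : 0 < K) {δ : ℝ}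
    (hδ : δ ∈ Set.Ioo (0 : ℝ) 1) {c : ℝ} (hc : 4 ≤ c) : 1 ≤ c * logFactor S A H K δ := by
  have h1 := log_two_le_logFactor (S := S) (A := A) hH hK hδ
  have h2 := Real.log_two_gt_d9
  nlinarith

/-- With probability at least `1 - δ` the true transition function is in all confidence sets. -/
lemma measureReal_not_plausible_le [Nonempty S] [Nonempty A] (hint : IsInteraction M μ ℱ X π)
    (hH : 0 < H) (hK : 0 < K) {δ : ℝ} (hδ : δ ∈ Set.Ioo (0 : ℝ) 1) {c : ℝ} (hc : 4 ≤ c) :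
    μ.real {ω | ∃ k, (fun _ => M.trans) ∉
      plausible c δ (record X π ω).1 (record X π ω).2 k} ≤ δ := by
  set L := logFactor S A H K δ with hL
  have hcL : 1 ≤ c * L := one_le_mul_logFactor hH hK hδ hc
  have hs1 : (1 : ℝ) ≤ Fintype.card S := by exact_mod_cast Fintype.card_pos
  set Γ : ℝ := c * Fintype.card S * L with hΓ
  have hΓ1 : 1 ≤ Γ := by
    have := one_le_mul_of_one_le_of_one_le hcL hs1
    calc 1 ≤ c * L * Fintype.card S := this
      _ = Γ := by rw [hΓ]; ring
  -- The Chernoff parameter must be deterministic but should be tuned to the random visit count,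
  -- hence one event per possible count; the last index encodes that count minus one.
  let E : Fin K × S × A × Finset S × Fin (K * H) → Set Ω := fun e =>
    {ω | Γ / 2 ≤ √(Γ / ((e.2.2.2.2 : ℕ) + 1 : ℝ)) *
      (∑ y, signVec e.2.2.2.1 y *
          (transVisits (record X π ω).1 (record X π ω).2 e.1 e.2.1 e.2.2.1 y : ℝ)
        - visits (record X π ω).1 (record X π ω).2 e.1 e.2.1 e.2.2.1 *
          ∑ y, M.trans e.2.1 e.2.2.1 y * signVec e.2.2.2.1 y)
        - visits (record X π ω).1 (record X π ω).2 e.1 e.2.1 e.2.2.1 *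
          ((√(Γ / ((e.2.2.2.2 : ℕ) + 1 : ℝ))) ^ 2 / 2)}
  have hsub : {ω | ∃ k, (fun _ => M.trans) ∉
      plausible c δ (record X π ω).1 (record X π ω).2 k} ⊆ ⋃ e, E e := by
    rintro ω ⟨k, hk⟩
    simp only [plausible, Set.mem_ofPred_eq, not_forall] at hk
    obtain ⟨h, x, a, hk⟩ := hk
    have hw : width c δ (record X π ω).1 (record X π ω).2 k x a <
        ∑ y, |M.trans x a y - empTrans (record X π ω).1 (record X π ω).2 k x a y| := by
      by_contra hcon
      exact hk ⟨M.trans_mem x a, not_lt.1 hcon⟩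
    set z := record X π ω
    obtain ⟨B, hB⟩ := exists_sum_signVec
      (fun y => empTrans z.1 z.2 k x a y - M.trans x a y)
    simp_rw [abs_sub_comm (M.trans x a _)] at hw
    rw [hB] at hw
    have hNle := visits_le z.1 z.2 k x a
    -- Without visits the empirical vector is zero, at distance exactly one from the truth, which
    -- the width covers.
    rcases Nat.eq_zero_or_pos (visits z.1 z.2 k x a) with hN | hN
    · exfalso
      have hemp : ∀ y, empTrans z.1 z.2 k x a y = 0 := by
        intro y
        have : transVisits z.1 z.2 k x a y = 0 := by
          refine Nat.le_zero.1 (le_trans ?_ hN.le)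
          refine Finset.sum_le_sum fun j _ => Finset.sum_le_sum fun i _ => ?_
          split_ifs with h1 h2
          · exact le_rfl
          · exact absurd ⟨h1.1, h1.2.1⟩ h2
          · exact Nat.zero_le _
          · exact le_rfl
        simp [empTrans, this]
      rw [← hB] at hw
      simp_rw [hemp, zero_sub, abs_neg, abs_of_nonneg ((M.trans_mem x a).1 _)] at hw
      rw [(M.trans_mem x a).2, width, hN] at hw
      have : (1 : ℝ) ≤ √(c * (Fintype.card S : ℝ) * logFactor S A H K δ /
          ((max 0 1 : ℕ) : ℝ)) := by
        rw [Real.one_le_sqrt]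
        simpa using hΓ1
      linarith
    · refine Set.mem_iUnion.2 ⟨(k, x, a, B, ⟨visits z.1 z.2 k x a - 1, by omega⟩), ?_⟩
      have hcast : (((visits z.1 z.2 k x a - 1 : ℕ) : ℝ) + 1) = visits z.1 z.2 k x a := by
        rw [← Nat.cast_add_one, Nat.sub_add_cancel hN]
      simp only [E, Set.mem_ofPred_eq]
      rw [hcast]
      set N := visits z.1 z.2 k x a with hNdef
      have hN' : (0 : ℝ) < N := by exact_mod_cast hN
      have hmax : max N 1 = N := max_eq_left hN
      have hwid : width c δ z.1 z.2 k x a = √(Γ / N) := by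
        rw [width, ← hNdef, hmax]
      have hdev : ∑ y, signVec B y * (transVisits z.1 z.2 k x a y : ℝ)
          - N * ∑ y, M.trans x a y * signVec B y =
          N * ∑ y, signVec B y * (empTrans z.1 z.2 k x a y - M.trans x a y) := by
        simp only [empTrans, ← hNdef, hmax]
        rw [Finset.mul_sum, Finset.mul_sum, ← Finset.sum_sub_distrib]
        refine Finset.sum_congr rfl fun y _ => ?_
        field_simp
      rw [hwid] at hw
      rw [hdev]
      have ht0 : 0 ≤ √(Γ / N) := Real.sqrt_nonneg _
      have ht2 : √(Γ / N) ^ 2 * N = Γ := by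
        rw [Real.sq_sqrt (by positivity)]
        field_simp
      -- With `t = √(Γ / N)` the linear part is at least `t * N * √(Γ / N) = Γ`, and the correction
      -- `N * t ^ 2 / 2` equals `Γ / 2`.
      have := mul_le_mul_of_nonneg_left hw.le (mul_nonneg ht0 hN'.le)
      nlinarith
  have hE : ∀ e, μ.real (E e) ≤ Real.exp (-(Γ / 2)) := fun e =>
    measureReal_transVisits_le hint e.1 e.2.1 e.2.2.1 _ (abs_signVec_le _) _ _
  calc _ ≤ μ.real (⋃ e, E e) := measureReal_mono hsub
    _ ≤ ∑ e, μ.real (E e) := measureReal_iUnion_fintype_le _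
    _ ≤ ∑ _e : Fin K × S × A × Finset S × Fin (K * H), Real.exp (-(Γ / 2)) :=
        Finset.sum_le_sum fun e _ => hE e
    _ ≤ δ := by
        rw [Finset.sum_const, nsmul_eq_mul]
        simp only [Finset.card_univ, Fintype.card_prod, Fintype.card_fin, Fintype.card_finset]
        have := union_bound_le (Fintype.card_pos (α := S)) (Fintype.card_pos (α := A)) hK hH hδ hc
        push_cast at this ⊢
        exact this

end ConfidenceSet

/-! ### Summation of the confidence widths. -/

/-- Summing the confidence widths `min {1, B / √N}` when the counter `N` is updated only between
episodes, and grows by at most `H` per episode. -/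
lemma sum_mul_min_le {K : ℕ} (n : Fin K → ℕ) (H : ℕ) (hn : ∀ k, n k ≤ H) {B : ℝ} (hB : 0 ≤ B) :
    ∑ k, (n k : ℝ) * min 1 (B / √((max (∑ j ∈ Finset.Iio k, n j) 1 : ℕ) : ℝ)) ≤
      min ((∑ k, n k : ℕ) : ℝ) (2 * H) + 5 / 2 * B * √((∑ k, n k : ℕ) : ℝ) := by
  induction K with
  | zero => simp
  | succ K ih =>
    have ih' := ih (fun k => n k.castSucc) (fun k => hn _)
    have h1 : ∀ k : Fin K, ∑ j ∈ Finset.Iio k.castSucc, n j =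
        ∑ j ∈ Finset.Iio k, n j.castSucc := fun k => by
      rw [Fin.Iio_castSucc, Finset.sum_map]; rfl
    have h2 : ∑ j ∈ Finset.Iio (Fin.last K), n j = ∑ k : Fin K, n k.castSucc := by
      rw [Fin.Iio_last_eq_map, Finset.sum_map]; rfl
    rw [Fin.sum_univ_castSucc, Fin.sum_univ_castSucc, h2]
    simp_rw [h1]
    set N := ∑ k : Fin K, n k.castSucc
    set d := n (Fin.last K)
    have hd : d ≤ H := hn _
    have hd' : (d : ℝ) ≤ H := by exact_mod_cast hd
    have hd0 : (0 : ℝ) ≤ d := Nat.cast_nonneg _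
    have hsq : √(N : ℝ) ≤ √((N + d : ℕ) : ℝ) := Real.sqrt_le_sqrt (by push_cast; linarith)
    rcases lt_or_ge N H with hNH | hNH
    -- While the counter is below `H`, rounds are charged at most one each; the total after this
    -- episode is still at most `2 * H`.
    · have hNH' : (N : ℝ) ≤ H := by exact_mod_cast hNH.le
      rw [min_eq_left (by linarith)] at ih'
      rw [min_eq_left (show ((N + d : ℕ) : ℝ) ≤ 2 * H by push_cast; linarith)]
      have h3 : (d : ℝ) * min 1 (B / √((max N 1 : ℕ) : ℝ)) ≤ d * 1 :=
        mul_le_mul_of_nonneg_left (min_le_left _ _) hd0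
      have h4 : 5 / 2 * B * √(N : ℝ) ≤ 5 / 2 * B * √((N + d : ℕ) : ℝ) :=
        mul_le_mul_of_nonneg_left hsq (by positivity)
      push_cast at *
      linarith
    · have h3 : min (N : ℝ) (2 * H) ≤ min ((N + d : ℕ) : ℝ) (2 * H) :=
        min_le_min_right _ (by push_cast; linarith)
      suffices (d : ℝ) * min 1 (B / √((max N 1 : ℕ) : ℝ)) ≤
          5 / 2 * B * (√((N + d : ℕ) : ℝ) - √(N : ℝ)) by linarith
      rcases Nat.eq_zero_or_pos N with hN | hN
      · have : d = 0 := by omega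
        simp [this]
      · have hN' : (0 : ℝ) < N := by exact_mod_cast hN
        have hdN : (d : ℝ) ≤ N := by exact_mod_cast hd.trans hNH
        rw [max_eq_left (show 1 ≤ N from hN)]
        refine (mul_le_mul_of_nonneg_left (min_le_right _ _) hd0).trans ?_
        have hs0 : 0 < √(N : ℝ) := Real.sqrt_pos.2 hN'
        set a := √(N : ℝ)
        set b := √((N + d : ℕ) : ℝ)
        have ha2 : a ^ 2 = N := Real.sq_sqrt hN'.le
        have hb2 : b ^ 2 = N + d := by
          rw [Real.sq_sqrt (Nat.cast_nonneg _)]; push_cast; ring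
        -- From `d ≤ N` one gets `b ≤ √2 * a ≤ 3 / 2 * a`; then `b + a ≤ 5 / 2 * a`, the source of
        -- the constant.
        have hba : b ≤ 3 / 2 * a := by
          refine abs_le_of_sq_le_sq' ?_ (by positivity) |>.2
          nlinarith
        have hdiff : (d : ℝ) ≤ 5 / 2 * a * (b - a) := by
          have : (d : ℝ) = (b + a) * (b - a) := by nlinarith
          rw [this]
          exact mul_le_mul_of_nonneg_right (by linarith) (by linarith)
        rw [mul_div_assoc', div_le_iff₀ hs0]
        calc (d : ℝ) * B ≤ 5 / 2 * a * (b - a) * B := mul_le_mul_of_nonneg_right hdiff hB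
          _ = _ := by ring

/-! ### Optimism and the regret decomposition. -/

section Regret

variable {S A : Type*} [Fintype S] [Fintype A] {H K : ℕ}

/-- The widths along a run, summed over all rounds. -/
lemma sum_min_width_le (s : Fin K → Fin (H + 1) → S) (π : Fin K → Policy S A H) {B : ℝ}
    (hB : 0 ≤ B) :
    ∑ k, ∑ h : Fin H, min 1 (B / √((max
        (visits s π k (s k h.castSucc) (π k h (s k h.castSucc))) 1 : ℕ) : ℝ)) ≤
      Fintype.card S * Fintype.card A * (2 * H)
        + 5 / 2 * B * √(Fintype.card S * Fintype.card A * ((K : ℝ) * H)) := by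
  let n : S × A → Fin K → ℕ := fun e k => ∑ h : Fin H,
    if s k h.castSucc = e.1 ∧ π k h (s k h.castSucc) = e.2 then 1 else 0
  have hnH : ∀ e k, n e k ≤ H := fun e k => by
    calc n e k ≤ ∑ _h : Fin H, 1 := Finset.sum_le_sum fun h _ => by split_ifs <;> simp
      _ = H := by simp
  have hfiber : ∀ k (h : Fin H) (g : S × A → ℝ),
      ∑ e : S × A, ((if s k h.castSucc = e.1 ∧ π k h (s k h.castSucc) = e.2 then 1 else 0 : ℕ) : ℝ)
        * g e = g (s k h.castSucc, π k h (s k h.castSucc)) := by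
    intro k h g
    rw [Finset.sum_eq_single (s k h.castSucc, π k h (s k h.castSucc))]
    · simp
    · rintro ⟨x, a⟩ - hne
      rw [if_neg]
      · simp
      · rintro ⟨rfl, rfl⟩
        exact hne rfl
    · simp
  have hreorder : ∀ g : Fin K → S × A → ℝ,
      ∑ k, ∑ h : Fin H, g k (s k h.castSucc, π k h (s k h.castSucc)) =
        ∑ e, ∑ k, (n e k : ℝ) * g k e := by
    intro g
    conv_rhs => rw [Finset.sum_comm]
    refine Finset.sum_congr rfl fun k _ => ?_
    simp only [n, Nat.cast_sum, Finset.sum_mul]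
    rw [Finset.sum_comm]
    exact Finset.sum_congr rfl fun h _ => (hfiber k h (g k)).symm
  have htotal : ∑ e, ((∑ k, n e k : ℕ) : ℝ) = (K : ℝ) * H := by
    have := hreorder fun _ _ => 1
    simp only [mul_one] at this
    push_cast
    rw [← this]
    simp
  have hCS : ∑ e, √((∑ k, n e k : ℕ) : ℝ) ≤
      √(Fintype.card S * Fintype.card A * ((K : ℝ) * H)) := by
    refine Real.le_sqrt_of_sq_le ?_
    have := sq_sum_le_card_mul_sum_sq (s := (Finset.univ : Finset (S × A)))
      (f := fun e => √((∑ k, n e k : ℕ) : ℝ))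
    simp_rw [Real.sq_sqrt (Nat.cast_nonneg _)] at this
    rw [htotal, Finset.card_univ, Fintype.card_prod] at this
    push_cast at this ⊢
    exact this
  calc _ = ∑ e, ∑ k, (n e k : ℝ) *
        min 1 (B / √((max (∑ j ∈ Finset.Iio k, n e j) 1 : ℕ) : ℝ)) :=
        hreorder fun k e => min 1 (B / √((max (visits s π k e.1 e.2) 1 : ℕ) : ℝ))
    _ ≤ ∑ e : S × A, (2 * (H : ℝ) + 5 / 2 * B * √((∑ k, n e k : ℕ) : ℝ)) := by
        refine Finset.sum_le_sum fun e _ => (sum_mul_min_le (n e) H (hnH e) hB).trans ?_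
        exact add_le_add (min_le_right _ _) le_rfl
    _ = Fintype.card S * Fintype.card A * (2 * H)
          + 5 / 2 * B * ∑ e, √((∑ k, n e k : ℕ) : ℝ) := by
        rw [Finset.sum_add_distrib, Finset.sum_const, ← Finset.mul_sum, Finset.card_univ,
          Fintype.card_prod, nsmul_eq_mul]
        push_cast
        rfl
    _ ≤ _ := by gcongr

lemma regret_le_mul (M : EpisodicMDP S A H) (s : Fin K → Fin (H + 1) → S)
    (π : Fin K → Policy S A H) : regret M s π ≤ (K : ℝ) * H := by
  calc regret M s π ≤ ∑ _k : Fin K, (H : ℝ) := by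
        refine Finset.sum_le_sum fun k _ => ?_
        have hval := fun π' : Policy S A H => valueFn_mem_Icc M.reward M.reward_mem
          (fun _ => M.trans) (fun _ => M.trans_mem) π' (s k 0)
        have : Nonempty (Policy S A H) := ⟨π k⟩
        have h1 : M.optValue (s k 0) ≤ H := ciSup_le fun π' => (hval π').2
        have h2 : 0 ≤ M.value (π k) (s k 0) := (hval (π k)).1
        linarith
    _ = _ := by simp

/-- A transition function from `Q` that makes `π` optimistic at `x`, if there is one. -/
def optModel (M : EpisodicMDP S A H) (Q : Set (Transition S A H)) (π : Policy S A H) (x : S) :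
    Transition S A H :=
  if h : ∃ p ∈ Q, ∀ π' : Policy S A H, ∀ p' ∈ Q,
      valueFn M.reward p' π' x ≤ valueFn M.reward p π x
  -- The fallback is stochastic, so the bounds on the value gap hold for every record, as Azuma
  -- requires.
  then h.choose else fun _ => M.trans

/-- The optimistic transition function of episode `k`. -/
def episodeModel (M : EpisodicMDP S A H) (c δ : ℝ) (z : History S A H K) (k : Fin K) :
    Transition S A H :=
  optModel M (plausible c δ z.1 z.2 k) (z.2 k) (z.1 k 0)

lemma episodeModel_mem (M : EpisodicMDP S A H) (c δ : ℝ) (z : History S A H K) (k : Fin K)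
    (h : Fin H) (x : S) (a : A) : episodeModel M c δ z k h x a ∈ stdSimplex ℝ S := by
  unfold episodeModel optModel
  split_ifs with hex
  · exact (hex.choose_spec.1 h x a).1
  · exact M.trans_mem x a

lemma episodeModel_spec {M : EpisodicMDP S A H} {c δ : ℝ} {z : History S A H K}
    (hrun : IsUCRL2Run M.reward c δ z.1 z.2) (k : Fin K) :
    episodeModel M c δ z k ∈ plausible c δ z.1 z.2 k ∧
      ∀ π' : Policy S A H, ∀ p' ∈ plausible c δ z.1 z.2 k,
        valueFn M.reward p' π' (z.1 k 0) ≤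
          valueFn M.reward (episodeModel M c δ z k) (z.2 k) (z.1 k 0) := by
  unfold episodeModel optModel
  rw [dif_pos (hrun k)]
  exact (hrun k).choose_spec

/-- The gap between the optimistic and the true value functions of the policy of episode `k`. -/
def valueGap (M : EpisodicMDP S A H) (c δ : ℝ) (z : History S A H K) (k : Fin K)
    (h : Fin (H + 1)) (x : S) : ℝ :=
  stageValue M.reward (episodeModel M c δ z k) (z.2 k) h x
    - stageValue M.reward (fun _ => M.trans) (z.2 k) h x

/-- The chosen model depends only on the confidence set, the policy and the initial state, all known
before the first action of the episode. A choice made separately for each outcome could depend on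
the future. -/
lemma adapted_valueGap (M : EpisodicMDP S A H) (c δ : ℝ) (m : Fin K × Fin H) :
    Adapted m (fun z => valueGap M c δ z m.1) := by
  intro z z' h
  ext i x
  simp only [valueGap, episodeModel, plausible_eq_of_agree c δ h, h.2.2 m.1 le_rfl,
    h.2.1 0 (Fin.zero_le _)]

lemma abs_valueGap_le (M : EpisodicMDP S A H) (c δ : ℝ) (z : History S A H K) (k : Fin K)
    (h : Fin (H + 1)) (x : S) : |valueGap M c δ z k h x| ≤ H := by
  have h1 := stageValue_mem_Icc M.reward M.reward_mem _ (episodeModel_mem M c δ z k) (z.2 k) h x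
  have h2 := stageValue_mem_Icc M.reward M.reward_mem _ (fun _ => M.trans_mem) (z.2 k) h x
  rw [valueGap, abs_le]
  constructor <;> linarith [h1.1, h1.2, h2.1, h2.2]

/-- Regret of UCRL2 when the true transition function is plausible in all episodes. -/
lemma regret_le_of_plausible {M : EpisodicMDP S A H} {c δ : ℝ} {z : History S A H K}
    (hrun : IsUCRL2Run M.reward c δ z.1 z.2)
    (hpl : ∀ k, (fun _ => M.trans) ∈ plausible c δ z.1 z.2 k) :
    regret M z.1 z.2 ≤
      H * (Fintype.card S * Fintype.card A * (2 * H)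
        + 5 / 2 * √(c * Fintype.card S * logFactor S A H K δ)
          * √(Fintype.card S * Fintype.card A * ((K : ℝ) * H)))
      + ∑ m : Fin K × Fin H, (∑ y, stepProb M m z y * valueGap M c δ z m.1 m.2.succ y
          - valueGap M c δ z m.1 m.2.succ (nextState m z)) := by
  have hepisode : ∀ k, M.optValue (z.1 k 0) - M.value (z.2 k) (z.1 k 0) ≤
      ∑ h : Fin H, (H * min 1 (√(c * Fintype.card S * logFactor S A H K δ) / √((max
        (visits z.1 z.2 k (z.1 k h.castSucc) (z.2 k h (z.1 k h.castSucc))) 1 : ℕ) : ℝ))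
        + (∑ y, stepProb M (k, h) z y * valueGap M c δ z k h.succ y
          - valueGap M c δ z k h.succ (nextState (k, h) z))) := by
    intro k
    obtain ⟨hmem, hopt⟩ := episodeModel_spec hrun k
    have : Nonempty (Policy S A H) := ⟨z.2 k⟩
    -- Optimism: the true model is among the competitors.
    have h1 : M.optValue (z.1 k 0) ≤
        valueFn M.reward (episodeModel M c δ z k) (z.2 k) (z.1 k 0) :=
      ciSup_le fun π' => hopt π' _ (hpl k)
    have h2 := valueFn_sub_valueFn M.reward (episodeModel M c δ z k) (fun _ => M.trans)
      (episodeModel_mem M c δ z k) (fun _ => M.trans_mem) (z.2 k) (z.1 k) (valueGap M c δ z k)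
      (fun _ _ => rfl)
    have h3 : M.optValue (z.1 k 0) - M.value (z.2 k) (z.1 k 0) ≤
        valueFn M.reward (episodeModel M c δ z k) (z.2 k) (z.1 k 0)
          - valueFn M.reward (fun _ => M.trans) (z.2 k) (z.1 k 0) := sub_le_sub_right h1 _
    refine h3.trans (h2.le.trans (Finset.sum_le_sum fun h _ => add_le_add ?_ le_rfl))
    set x := z.1 k h.castSucc
    set a := z.2 k h x
    have hH0 : (0 : ℝ) ≤ H := Nat.cast_nonneg _
    obtain ⟨h4, h5⟩ := sum_sub_mul_le (episodeModel_mem M c δ z k h x a) (M.trans_mem x a)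
      (V := stageValue M.reward (episodeModel M c δ z k) (z.2 k) h.succ) (B := H)
      (stageValue_mem_Icc M.reward M.reward_mem _ (episodeModel_mem M c δ z k) (z.2 k) h.succ)
    rw [mul_min_of_nonneg _ _ hH0, mul_one]
    refine le_min h5 (h4.trans ?_)
    have hdist : ∑ y, |episodeModel M c δ z k h x a y - M.trans x a y| ≤
        2 * width c δ z.1 z.2 k x a := by
      calc _ ≤ ∑ y, (|episodeModel M c δ z k h x a y - empTrans z.1 z.2 k x a y|
            + |M.trans x a y - empTrans z.1 z.2 k x a y|) := by
            refine Finset.sum_le_sum fun y _ => ?_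
            rw [abs_sub_comm (M.trans x a y)]
            exact abs_sub_le _ _ _
        _ ≤ _ := by
            rw [Finset.sum_add_distrib, two_mul]
            exact add_le_add (hmem h x a).2 (hpl k h x a).2
    rw [← Real.sqrt_div' _ (Nat.cast_nonneg _)]
    have := mul_le_mul_of_nonneg_left hdist (show (0 : ℝ) ≤ H / 2 by positivity)
    refine this.trans (le_of_eq ?_)
    rw [width]
    ring
  refine (Finset.sum_le_sum fun k _ => hepisode k).trans ?_
  simp only [Finset.sum_add_distrib]
  rw [Fintype.sum_prod_type]
  refine add_le_add ?_ le_rfl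
  simp only [← Finset.mul_sum]
  exact mul_le_mul_of_nonneg_left (sum_min_width_le z.1 z.2 (Real.sqrt_nonneg _))
    (Nat.cast_nonneg _)

end Regret

/-- Absorbing the lower-order term of the regret bound. -/
lemma regret_term_le {s a h T G : ℝ} (hs : 1 ≤ s) (ha : 0 ≤ a) (hh : 0 ≤ h) (hT : 0 < T)
    (hG : 1 ≤ G) (hlarge : 4 * √G * h * s * √(a * T) ≤ T) :
    h * (s * a * (2 * h) + 5 / 2 * √(s * G) * √(s * a * T)) ≤ 4 * √G * h * s * √(a * T) := by
  have hsG : √(s * G) * √(s * a * T) = √G * s * √(a * T) := by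
    rw [mul_assoc s a T, Real.sqrt_mul (by linarith), Real.sqrt_mul (by linarith)]
    have := Real.mul_self_sqrt (show 0 ≤ s by linarith)
    linear_combination √G * √(a * T) * this
  have hg0 : 1 ≤ √G := Real.one_le_sqrt.2 hG
  set g := √G
  set b := √(a * T)
  have hb0 : 0 ≤ b := Real.sqrt_nonneg _
  have hb2 : b * b = a * T := Real.mul_self_sqrt (by positivity)
  have hlow : 2 * (h * a) ≤ 3 / 2 * g * b := by
    -- For `b > 0`, multiplying `hlarge` by `a` and cancelling `b` gives `4 * a * g * h * s ≤ b`, so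
    -- `h * a` is of lower order.
    rcases hb0.eq_or_lt with hb | hb
    · rw [← hb] at hb2 ⊢
      rcases (mul_eq_zero.1 (by linarith : a * T = 0)) with ha0 | hT0
      · simp [ha0]
      · exact absurd hT0 hT.ne'
    · have h1 : a * (4 * g * h * s * b) ≤ a * T := mul_le_mul_of_nonneg_left hlarge ha
      rw [← hb2] at h1
      have h2 : a * (4 * g * h * s) ≤ b := by
        refine le_of_mul_le_mul_right ?_ hb
        linarith
      have h3 : h * a ≤ h * a * (g * s) :=
        le_mul_of_one_le_right (by positivity) (one_le_mul_of_one_le_of_one_le hg0 hs)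
      have h4 : b ≤ g * b := le_mul_of_one_le_left hb0 hg0
      linarith
  have h5 := mul_le_mul_of_nonneg_left hlow (show 0 ≤ h * s by positivity)
  rw [mul_assoc (5 / 2), hsG]
  linarith

end UCRL

end

/-! ### Assembly of the regret bound. -/

theorem mainTheorem5 {S A Ω : Type*} [Fintype S] [Fintype A] {mΩ : MeasurableSpace Ω}
    (μ : Measure Ω) [IsProbabilityMeasure μ] (H K : ℕ) (M : UCRL.EpisodicMDP S A H)
    (δ : ℝ) (hδ : δ ∈ Set.Ioo (0 : ℝ) 1) (c : ℝ) (hc : 4 ≤ c)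
    (ℱ : Filtration ℕ mΩ) (X : Fin K → Fin (H + 1) → Ω → S)
    (π : Fin K → Ω → UCRL.Policy S A H) (hint : UCRL.IsInteraction M μ ℱ X π)
    (halg : ∀ᵐ ω ∂μ,
      UCRL.IsUCRL2Run M.reward c δ (fun k h => X k h ω) (fun k => π k ω)) :
    1 - 2 * δ ≤ μ.real {ω |
      UCRL.regret M (fun k h => X k h ω) (fun k => π k ω) ≤
        4 * √(c * UCRL.logFactor S A H K δ) * H * Fintype.card S
            * √(Fintype.card A * ((K : ℝ) * H))
          + 2 * H * √(2 * ((K : ℝ) * H) * Real.log (1 / δ))} := by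
  set T : ℝ := (K : ℝ) * H with hT
  set L := UCRL.logFactor S A H K δ with hL
  set R : ℝ := 4 * √(c * L) * H * Fintype.card S * √(Fintype.card A * T) with hR
  set R' : ℝ := H * √(2 * T * Real.log (1 / δ)) with hR'
  have hR0 : 0 ≤ R := by positivity
  have hR'0 : 0 ≤ R' := by positivity
  have h2R' : 2 * (H : ℝ) * √(2 * T * Real.log (1 / δ)) = 2 * R' := by rw [hR']; ring
  rw [h2R']
  -- For `T ≤ R` the regret never exceeds `T`; this also covers `H = 0` and `K = 0`.
  rcases le_or_gt T R with hTR | hTR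
  · have huniv : {ω | UCRL.regret M (fun k h => X k h ω) (fun k => π k ω) ≤ R + 2 * R'} =
        Set.univ := by
      refine Set.eq_univ_of_forall fun ω => ?_
      have h1 : UCRL.regret M (fun k h => X k h ω) (fun k => π k ω) ≤ T :=
        UCRL.regret_le_mul M _ _
      rw [Set.mem_ofPred_eq]
      linarith
    rw [huniv, probReal_univ]
    linarith [hδ.1]
  have hT0 : 0 < T := hR0.trans_lt hTR
  have hK : 0 < K := Nat.pos_of_ne_zero fun h => by simp [hT, h] at hT0
  have hH : 0 < H := Nat.pos_of_ne_zero fun h => by simp [hT, h] at hT0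
  obtain ⟨ω₀⟩ : Nonempty Ω := nonempty_of_isProbabilityMeasure μ
  have hS : Nonempty S := ⟨X ⟨0, hK⟩ 0 ω₀⟩
  have hA : Nonempty A := ⟨π ⟨0, hK⟩ ω₀ ⟨0, hH⟩ hS.some⟩
  have hG : 1 ≤ c * L := UCRL.one_le_mul_logFactor hH hK hδ hc
  have hS1 : (1 : ℝ) ≤ Fintype.card S := by exact_mod_cast Fintype.card_pos
  have hmain := UCRL.regret_term_le (a := Fintype.card A) (h := H) hS1 (Nat.cast_nonneg _)
    (Nat.cast_nonneg _) hT0 hG hTR.le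
  have hconf := UCRL.measureReal_not_plausible_le hint hH hK hδ hc
  have hdev := UCRL.measureReal_deviation_le hint hH hK hδ (UCRL.valueGap M c δ)
    (UCRL.adapted_valueGap M c δ) (UCRL.abs_valueGap_le M c δ)
  set E₁ : Set Ω := {ω | ∃ k, (fun _ => M.trans) ∉
    UCRL.plausible c δ (UCRL.record X π ω).1 (UCRL.record X π ω).2 k} with hE₁
  set E₂ : Set Ω := {ω | R' ≤ ∑ m : Fin K × Fin H,
    (∑ y, UCRL.stepProb M m (UCRL.record X π ω) y *
        UCRL.valueGap M c δ (UCRL.record X π ω) m.1 m.2.succ y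
      - UCRL.valueGap M c δ (UCRL.record X π ω) m.1 m.2.succ
        (UCRL.nextState m (UCRL.record X π ω)))} with hE₂
  set E₃ : Set Ω := {ω | ¬ UCRL.IsUCRL2Run M.reward c δ (fun k h => X k h ω)
    (fun k => π k ω)} with hE₃
  set G : Set Ω := {ω | UCRL.regret M (fun k h => X k h ω) (fun k => π k ω) ≤ R + 2 * R'}
    with hGdef
  have hnull : μ.real E₃ = 0 := by
    rw [measureReal_def, ae_iff.1 halg, ENNReal.toReal_zero]
  have hcover : (Set.univ : Set Ω) ⊆ G ∪ (E₁ ∪ (E₂ ∪ E₃)) := by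
    intro ω _
    by_contra hω
    simp only [Set.mem_union, not_or] at hω
    obtain ⟨hω, h1, h2, h3⟩ := hω
    simp only [hE₁, hE₂, hE₃, hGdef, Set.mem_ofPred_eq, not_exists, not_not, not_le] at hω h1 h2 h3
    have h4 := UCRL.regret_le_of_plausible (z := UCRL.record X π ω) h3 h1
    have h5 : c * Fintype.card S * L = Fintype.card S * (c * L) := by ring
    rw [← hL, h5, ← hT] at h4
    have h6 : UCRL.regret M (UCRL.record X π ω).1 (UCRL.record X π ω).2 =
      UCRL.regret M (fun k h => X k h ω) (fun k => π k ω) := rfl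
    -- The argument gives `R + R'`; the second copy of `R'` is slack.
    linarith
  have h1 : (1 : ℝ) ≤ μ.real G + (μ.real E₁ + (μ.real E₂ + μ.real E₃)) := by
    rw [← probReal_univ (μ := μ)]
    refine (measureReal_mono hcover).trans ((measureReal_union_le _ _).trans ?_)
    gcongr
    refine (measureReal_union_le _ _).trans ?_
    gcongr
    exact measureReal_union_le _ _
  linarith
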